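/- Let $H$ be a separable infinite-dimensional complex Hilbert space, $K(H)^+$ the set of positive compact operators on $H$ and $F(H)^+$ the set of positive finite-rank operators. For $a\in K(H)^+$ let $\lambda_1(a)\ge\lambda_2(a)\ge\cdots$ be the list of the eigenvalues of $a$ in decreasing order, counted with multiplicity: if $a$ has infinite rank, only the nonzero eigenvalues are listed, and if $a$ has finite rank, the list of nonzero eigenvalues is continued by zeros. Write $\vee=\max$ (or $\sup$) and $\wedge=\min$. Let $\sigma(a)$ be the spectrum of $a$, let $C(\sigma(a))^+$ be the set of continuous functions $\sigma(a)\to[0,\infty)$, let $f(a)$ denote the continuous functional calculus, and for $k\ge 0$ let $kI\wedge a$ be $h(a)$ with $h(x)=\min(k,x)$. Functions $f,g$ on $\sigma(a)$ are comonotonic if $(f(s)-f(t))(g(s)-g(t))\ge 0$ for all $s,t\in\sigma(a)$. Let $\psi:K(H)^+\to[0,\infty)$ be an arbitrary (non-linear) map. Then the following are equivalent: 1. There is a monotone increasing function $\alpha:\{0,1,2,\dots\}\to[0,\infty)$ with $\alpha(0)=0$ such that $\psi(a)=\bigvee_{i=1}^{\infty}\bigl(\lambda_i(a)\wedge\alpha(i)\bigr)$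 for all $a\in K(H)^+$. 2. $\psi$ has the following six properties: (a) $\psi((f\vee g)(a))=\psi(f(a))\vee\psi(g(a))$ for all $a\in K(H)^+$ and all monotone increasing $f,g\in C(\sigma(a))^+$ with $f(0)=g(0)=0$; (b) $\psi(uau^*)=\psi(a)$ for all $a\in K(H)^+$ and all unitary $u\in B(H)$; (c) $a\le b$ implies $\psi(a)\le\psi(b)$ for all $a,b\in K(H)^+$; (d) $\psi(kI\wedge a)=k\wedge\psi(a)$ for all $a\in K(H)^+$ and all $k\ge 0$; (e) $\psi$ is lower semicontinuous on $K(H)^+$ in the operator norm; (f) for every $a\in F(H)^+$ the limit $\lim_{c\to\infty}\psi(ca)$ exists and is finite. 3. $\psi$ has properties (b)–(f) and (a') $\psi((f\vee g)(a))=\psi(f(a))\vee\psi(g(a))$ for all $a\in K(H)^+$ and all comonotonic $f,g\in C(\sigma(a))^+$ with $f(0)=g(0)=0$. -/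

import Mathlib

open scoped NNReal ENNReal Topology

namespace SugenoTrace

section

variable {H : Type*} [NormedAddCommGroup H] [InnerProductSpace ℂ H] [CompleteSpace H]

/-- Continuous functional calculus of a positive compact operator by a function vanishing at `0`
is compact. -/
theorem isCompactOperator_cfc {a : H →L[ℂ] H} (ha : IsCompactOperator a) (ha0 : 0 ≤ a)
    {f : ℝ≥0 → ℝ≥0} (hf0 : f 0 = 0) : IsCompactOperator (cfc f a : H →L[ℂ] H) := by
  by_cases hf : ContinuousOn f (spectrum ℝ≥0 a)
  swap
  · rw [cfc_apply_of_not_continuousOn a hf]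
    exact isCompactOperator_zero
  have hq : ContinuousOn f (quasispectrum ℝ≥0 a) := by
    rw [quasispectrum_eq_spectrum_union_zero]
    exact hf.union_of_isClosed (continuousOn_singleton f 0)
      (isCompact_iff_compactSpace.mpr inferInstance).isClosed isClosed_singleton
  rw [← cfcₙ_eq_cfc hq hf0, cfcₙ_nnreal_eq_real f a ha0]
  have hcl : IsClosed {T : H →L[ℂ] H | IsCompactOperator T} :=
    isClosed_setOfPred_isCompactOperator
  let S : NonUnitalStarSubalgebra ℝ (H →L[ℂ] H) :=
    { carrier := {T | IsCompactOperator T ∧ IsCompactOperator (star T : H →L[ℂ] H)}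
      add_mem' := fun {x y} hx hy =>
        ⟨hx.1.add hy.1, by rw [star_add]; exact hx.2.add hy.2⟩
      zero_mem' := ⟨isCompactOperator_zero, by rw [star_zero]; exact isCompactOperator_zero⟩
      mul_mem' := fun {x y} hx hy =>
        ⟨hx.1.comp_clm y, by rw [star_mul]; exact hy.2.comp_clm (star x)⟩
      smul_mem' := fun c x hx =>
        ⟨hx.1.smul c, by rw [star_smul]; exact hx.2.smul (star c)⟩
      star_mem' := fun {x} hx => ⟨hx.2, by rw [star_star]; exact hx.1⟩ }
  have hS : IsClosed (S : Set (H →L[ℂ] H)) :=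
    hcl.inter (hcl.preimage continuous_star)
  have haS : a ∈ S := ⟨ha, by rw [(IsSelfAdjoint.of_nonneg ha0).star_eq]; exact ha⟩
  exact (cfcₙ_mem (𝕜 := ℝ) (𝕜' := ℝ) (s := S) _ haS).1

end

/-- The set `K(H)⁺` of positive compact operators on `H`, with the topology of the operator norm
and the usual order of operators. -/
abbrev KPos (H : Type*) [NormedAddCommGroup H] [InnerProductSpace ℂ H] [CompleteSpace H] : Type _ :=
  {a : H →L[ℂ] H // IsCompactOperator a ∧ 0 ≤ a}

noncomputable section

variable {H : Type*} [NormedAddCommGroup H] [InnerProductSpace ℂ H] [CompleteSpace H]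

namespace KPos

/-- The functional calculus `f(a)` for `a ∈ K(H)⁺` and `f ≥ 0` with `f(0) = 0`; only the values
of `f` on the spectrum of `a` matter. -/
def funcCalc (a : KPos H) (f : ℝ≥0 → ℝ≥0) (hf0 : f 0 = 0) : KPos H :=
  ⟨cfc f a.1, isCompactOperator_cfc a.2.1 a.2.2 hf0, cfc_predicate f a.1⟩

/-- The operator `k I ∧ a`, that is, `g(a)` with `g(x) = min k x`. -/
def truncate (k : ℝ≥0) (a : KPos H) : KPos H :=
  a.funcCalc (fun x => min k x) (by simp)

/-- The operator `c a` for a scalar `c ≥ 0`. -/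
def scale (c : ℝ≥0) (a : KPos H) : KPos H :=
  ⟨(c : ℝ) • a.1, a.2.1.smul (c : ℝ), smul_nonneg c.2 a.2.2⟩

/-- The operator `u a u*` for a unitary `u`. -/
def conj (u : unitary (H →L[ℂ] H)) (a : KPos H) : KPos H :=
  ⟨(u : H →L[ℂ] H) * a.1 * star (u : H →L[ℂ] H),
    (a.2.1.clm_comp (u : H →L[ℂ] H)).comp_clm (star (u : H →L[ℂ] H)),
    star_right_conjugate_nonneg a.2.2 (u : H →L[ℂ] H)⟩

/-- The `(n+1)`-st entry `λ_{n+1}(a)` of the eigenvalue sequence of `a ∈ K(H)⁺`, that is, of the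
decreasing list of its eigenvalues counted with multiplicity (continued by zeros if `a` has finite
rank): the largest `t ≥ 0` such that at least `n+1` eigenvalues, counted with multiplicity,
are `≥ t`. The number of eigenvalues `≥ t` counted with multiplicity is the dimension of the sum of
the eigenspaces of the eigenvalues `s ≥ t`. -/
def eigenvalueSeq (a : KPos H) (n : ℕ) : ℝ≥0 :=
  sSup {t : ℝ≥0 | ((n + 1 : ℕ) : Cardinal) ≤
    Module.rank ℂ ↥(⨆ s ∈ Set.Ici t,
      Module.End.eigenspace (a.1 : H →ₗ[ℂ] H) (((s : ℝ≥0) : ℝ) : ℂ))}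

end KPos

/-- The non-linear trace of Sugeno type `ψ_α(a) = ⋁_{i ≥ 1} (λ_i(a) ∧ α(i))`. -/
def sugenoTrace (α : ℕ → ℝ≥0) (a : KPos H) : ℝ≥0∞ :=
  ⨆ n : ℕ, ((min (a.eigenvalueSeq n) (α (n + 1)) : ℝ≥0) : ℝ≥0∞)

/-- Two functions are comonotonic on `s`. -/
def ComonotonicOn (f g : ℝ≥0 → ℝ≥0) (s : Set ℝ≥0) : Prop :=
  ∀ x ∈ s, ∀ y ∈ s, 0 ≤ ((f x : ℝ) - f y) * ((g x : ℝ) - g y)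

variable (ψ : KPos H → ℝ≥0)

/-- `ψ` is unitarily invariant. -/
def UnitarilyInvariant : Prop :=
  ∀ (a : KPos H) (u : unitary (H →L[ℂ] H)), ψ (KPos.conj u a) = ψ a

/-- `ψ(k I ∧ a) = k ∧ ψ(a)`. -/
def PositivelyFHomogeneous : Prop :=
  ∀ (a : KPos H) (k : ℝ≥0), ψ (KPos.truncate k a) = min k (ψ a)

/-- `ψ((f ∨ g)(a)) = ψ(f(a)) ∨ ψ(g(a))` for comonotonic `f, g ∈ C(σ(a))⁺` vanishing at `0`. -/
def ComonotonicFAdditive : Prop :=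
  ∀ (a : KPos H) (f g : ℝ≥0 → ℝ≥0) (hf0 : f 0 = 0) (hg0 : g 0 = 0),
    ContinuousOn f (spectrum ℝ≥0 a.1) → ContinuousOn g (spectrum ℝ≥0 a.1) →
    ComonotonicOn f g (spectrum ℝ≥0 a.1) →
    ψ (a.funcCalc (fun x => max (f x) (g x)) (by simp [hf0, hg0])) =
      max (ψ (a.funcCalc f hf0)) (ψ (a.funcCalc g hg0))

/-- `ψ((f ∨ g)(a)) = ψ(f(a)) ∨ ψ(g(a))` for monotone increasing `f, g ∈ C(σ(a))⁺` vanishing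
at `0`. -/
def MonotonicIncreasingFAdditive : Prop :=
  ∀ (a : KPos H) (f g : ℝ≥0 → ℝ≥0) (hf0 : f 0 = 0) (hg0 : g 0 = 0),
    ContinuousOn f (spectrum ℝ≥0 a.1) → ContinuousOn g (spectrum ℝ≥0 a.1) →
    MonotoneOn f (spectrum ℝ≥0 a.1) → MonotoneOn g (spectrum ℝ≥0 a.1) →
    ψ (a.funcCalc (fun x => max (f x) (g x)) (by simp [hf0, hg0])) =
      max (ψ (a.funcCalc f hf0)) (ψ (a.funcCalc g hg0))

/-- For every positive finite rank operator `a`, the limit of `ψ(c a)` as `c → ∞` is finite. -/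
def FiniteLimitOnFiniteRank : Prop :=
  ∀ a : KPos H, FiniteDimensional ℂ (LinearMap.range (a.1 : H →ₗ[ℂ] H)) →
    ∃ L : ℝ≥0, Filter.Tendsto (fun c : ℝ≥0 => ψ (KPos.scale c a)) Filter.atTop (𝓝 L)

end

end SugenoTrace

/-! A positive compact operator is diagonal in some Hilbert basis, with entries `μ i ≥ 0`. In these
terms `r < ψ_α(a)` says that for some `n` both `r < α (n + 1)` and at least `n + 1` entries exceed
`r` (`IsDiagonal.lt_sugenoTrace_iff`). By Courant–Fischer the count has a basis-free form: the
quadratic form of `a` is at least `t‖x‖²`, for some `t > r`, on a subspace of dimension `n + 1`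
(`lt_sugenoTrace_iff_exists_submodule`).

The properties of `ψ_α` are read off one of these two forms. The basis-free one serves when the
operators share no diagonalisation (order, norm perturbation, conjugation), the counting one for
functional calculus and finite rank.

Conversely, unitary invariance makes `ψ(k p)` depend only on `k` and the rank of the projection `p`;
homogeneity and the finite limit give `ψ(k p) = k ∧ α(rank p)`. For the lower bound on `ψ(a)`,
compare `a` with multiples `t p ≤ a`. For the upper bound, `a` lies below the maximum of `r ∧ a` and
`‖a‖` times its spectral projection above `r`; both are increasing functions of `a`, so maxitivity
gives `ψ(a) ≤ r ∨ α(#{μ > r})` (`le_max_of_scale_proj_eq`). -/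

namespace SugenoTrace

universe u

/-! ### Diagonalisation of positive compact operators -/

section Diagonal

variable {H : Type u} [NormedAddCommGroup H] [InnerProductSpace ℂ H]

/-- The operator `a` is diagonal in the Hilbert basis `b`, with entries `μ ≥ 0`. -/
def IsDiagonal {ι : Type*} (b : HilbertBasis ι ℂ H) (a : H →L[ℂ] H) (μ : ι → ℝ≥0) : Prop :=
  ∀ i, a (b i) = ((μ i : ℝ) : ℂ) • b i

theorem continuousLinearMap_ext_hilbertBasis {ι : Type*} (b : HilbertBasis ι ℂ H)
    {S T : H →L[ℂ] H} (h : ∀ i, S (b i) = T (b i)) : S = T := by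
  have hd : Dense (Submodule.span ℂ (Set.range b) : Set H) := by
    rw [Submodule.dense_iff_topologicalClosure_eq_top]
    exact b.dense_span
  exact ContinuousLinearMap.ext_on hd (by rintro _ ⟨i, rfl⟩; exact h i)

theorem le_iff_re_inner_le [CompleteSpace H] {a c : H →L[ℂ] H} (ha : 0 ≤ a) (hc : 0 ≤ c) :
    a ≤ c ↔ ∀ x, (inner ℂ x (a x)).re ≤ (inner ℂ x (c x)).re := by
  have hsa : IsSelfAdjoint (c - a) := (IsSelfAdjoint.of_nonneg hc).sub (.of_nonneg ha)
  constructor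
  · intro h x
    have := (ContinuousLinearMap.le_def _ _).1 h |>.re_inner_nonneg_right x
    simpa [inner_sub_right] using this
  · intro h
    rw [ContinuousLinearMap.le_def]
    refine ContinuousLinearMap.isPositive_def'.2 ⟨hsa, fun x => ?_⟩
    rw [ContinuousLinearMap.reApplyInnerSelf_apply, inner_re_symm]
    simpa [inner_sub_right] using h x

namespace IsDiagonal

variable {ι : Type*} {b : HilbertBasis ι ℂ H} {a c : H →L[ℂ] H} {μ ν : ι → ℝ≥0}

theorem eq (ha : IsDiagonal b a μ) (hc : IsDiagonal b c μ) : a = c :=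
  continuousLinearMap_ext_hilbertBasis b fun i => by rw [ha i, hc i]

theorem inner_apply [CompleteSpace H] (ha : IsDiagonal b a μ) (hsa : 0 ≤ a) (x : H) (i : ι) :
    inner ℂ (b i) (a x) = ((μ i : ℝ) : ℂ) * inner ℂ (b i) x := by
  have h := ((ContinuousLinearMap.nonneg_iff_isPositive a).1 hsa).isSymmetric (b i) x
  simp only [ContinuousLinearMap.coe_coe, ha i, inner_smul_left, Complex.conj_ofReal] at h
  exact h.symm

theorem hasSum_re_inner [CompleteSpace H] (ha : IsDiagonal b a μ) (hsa : 0 ≤ a) (x : H) :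
    HasSum (fun i => (μ i : ℝ) * ‖inner ℂ (b i) x‖ ^ 2) (inner ℂ x (a x)).re := by
  have h := (b.hasSum_inner_mul_inner x (a x)).mapL Complex.reCLM
  simp only [Complex.reCLM_apply] at h
  convert h using 2 with i
  rw [ha.inner_apply hsa, mul_left_comm, Complex.re_ofReal_mul, ← inner_conj_symm x (b i),
    Complex.conj_mul', ← Complex.ofReal_pow, Complex.ofReal_re]

theorem le_of_le [CompleteSpace H] (ha : IsDiagonal b a μ) (hc : IsDiagonal b c ν)
    (ha0 : 0 ≤ a) (hc0 : 0 ≤ c) (h : ∀ i, μ i ≤ ν i) : a ≤ c := by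
  rw [le_iff_re_inner_le ha0 hc0]
  exact fun x => hasSum_le (fun i => by have := h i; gcongr)
    (ha.hasSum_re_inner ha0 x) (hc.hasSum_re_inner hc0 x)

theorem mem_spectrum_real (ha : IsDiagonal b a μ) (i : ι) : (μ i : ℝ) ∈ spectrum ℝ a := by
  rw [spectrum.mem_iff]
  intro h
  have hz : (algebraMap ℝ (H →L[ℂ] H) (μ i) - a) (b i) = 0 := by
    rw [Algebra.algebraMap_eq_smul_one]
    simp [ha i]
  obtain ⟨v, hv⟩ := h
  have : b i = 0 := by
    have h1 : (↑v⁻¹ * ↑v : H →L[ℂ] H) (b i) = b i := by simp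
    rw [hv] at h1
    rw [← h1, mul_apply_eq_comp, hz, map_zero]
  exact b.orthonormal.ne_zero i this

theorem mem_spectrum (ha : IsDiagonal b a μ) (i : ι) : μ i ∈ spectrum ℝ≥0 a := by
  rw [← spectrum.algebraMap_mem_iff ℝ]
  exact ha.mem_spectrum_real i

end IsDiagonal

variable [CompleteSpace H]

/-- The functions for which this holds form a closed subalgebra containing the constants and the
identity, so Stone–Weierstrass applies. -/
theorem cfc_real_apply_eigenvector {a : H →L[ℂ] H} (ha : IsSelfAdjoint a) {f : ℝ → ℝ}
    (hf : ContinuousOn f (spectrum ℝ a)) {t : ℝ} (ht : t ∈ spectrum ℝ a) {e : H}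
    (he : a e = (t : ℂ) • e) : cfc f a e = (f t : ℂ) • e := by
  rw [cfc_apply f a]
  have key : ∀ g : C(spectrum ℝ a, ℝ), cfcHom ha g e = (g ⟨t, ht⟩ : ℂ) • e := by
    intro g
    induction g using ContinuousMap.induction_on_of_compact with
    | const r =>
      have : ContinuousMap.const (spectrum ℝ a) r = algebraMap ℝ C(spectrum ℝ a, ℝ) r := rfl
      rw [this, AlgHomClass.commutes]
      simp [Algebra.algebraMap_eq_smul_one]
    | id => rw [cfcHom_id]; simpa using he
    | star_id => rw [map_star, cfcHom_id, ha.star_eq]; simpa using he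
    | add f g hf hg => simp [hf, hg, add_smul]
    | mul f g hf hg => 
      rw [map_mul, mul_apply_eq_comp, hg, map_smul, hf, smul_smul, mul_comm]
      simp
    | frequently f h =>
      refine h.mem_of_closed (s := {g : C(spectrum ℝ a, ℝ) | cfcHom ha g e = (g ⟨t, ht⟩ : ℂ) • e}) ?_
      refine isClosed_eq ?_ ?_
      · exact ((ContinuousLinearMap.apply ℂ H e).continuous).comp (cfcHom_continuous ha)
      · fun_prop
  exact key _

theorem IsDiagonal.cfc {ι : Type*} {b : HilbertBasis ι ℂ H} {a : H →L[ℂ] H} {μ : ι → ℝ≥0}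
    (ha : IsDiagonal b a μ) (ha0 : 0 ≤ a) {f : ℝ≥0 → ℝ≥0}
    (hf : ContinuousOn f (spectrum ℝ≥0 a)) : IsDiagonal b (cfc f a) (fun i => f (μ i)) := by
  intro i
  have hc : ContinuousOn (fun x : ℝ => (f x.toNNReal : ℝ)) (spectrum ℝ a) := by
    refine NNReal.continuous_coe.comp_continuousOn
      (hf.comp continuous_real_toNNReal.continuousOn fun x hx => ?_)
    rw [← spectrum.algebraMap_mem_iff ℝ]
    have : 0 ≤ x := spectrum_nonneg_of_nonneg ha0 hx
    simpa [this] using hx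
  rw [cfc_nnreal_eq_real f a ha0,
    cfc_real_apply_eigenvector (.of_nonneg ha0) hc (ha.mem_spectrum_real i) (ha i)]
  simp

/-- Spectral theorem: Hilbert bases of the eigenspaces together form an orthonormal family, which is
complete because the eigenspaces have trivial common orthogonal complement. -/
theorem exists_isDiagonal {a : H →L[ℂ] H} (ha : IsCompactOperator a) (ha0 : 0 ≤ a) :
    ∃ (ι : Type u) (b : HilbertBasis ι ℂ H) (μ : ι → ℝ≥0), IsDiagonal b a μ := by
  have hpos := (ContinuousLinearMap.nonneg_iff_isPositive a).1 ha0
  have hsym : (a : H →ₗ[ℂ] H).IsSymmetric := hpos.isSymmetric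
  have hbot := ContinuousLinearMap.orthogonalComplement_iSup_eigenspaces_eq_bot ha hsym
  choose w bw hbw using fun s : ℂ =>
    exists_hilbertBasis ℂ (Module.End.eigenspace (a : H →ₗ[ℂ] H) s)
  have hon := hsym.orthogonalFamily_eigenspaces.orthonormal_sigma_orthonormal
    (fun s => (bw s).orthonormal)
  have horth : (Submodule.span ℂ (Set.range fun p : Σ s, w s =>
      (Module.End.eigenspace (a : H →ₗ[ℂ] H) p.1).subtypeₗᵢ (bw p.1 p.2)))ᗮ = ⊥ := by
    rw [eq_bot_iff, ← hbot]
    refine fun x hx => Submodule.mem_orthogonal _ _ |>.2 fun y hy => ?_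
    refine Submodule.iSup_induction _ (motive := fun y => inner ℂ y x = 0) hy (fun s z hz => ?_)
      (inner_zero_left _) fun y z hy hz => by rw [inner_add_left, hy, hz, add_zero]
    have hp : (Module.End.eigenspace (a : H →ₗ[ℂ] H) s).subtypeL.adjoint x = 0 := by
      refine (bw s).repr.injective ?_
      ext i
      rw [HilbertBasis.repr_apply_apply, ContinuousLinearMap.adjoint_inner_right]
      simpa using Submodule.mem_orthogonal _ _ |>.1 hx _ (Submodule.subset_span ⟨⟨s, i⟩, rfl⟩)
    have := ContinuousLinearMap.adjoint_inner_right
      (Module.End.eigenspace (a : H →ₗ[ℂ] H) s).subtypeL ⟨z, hz⟩ x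
    rw [hp, inner_zero_right] at this
    exact this.symm
  let b := HilbertBasis.mkOfOrthogonalEqBot hon horth
  have hb : ∀ p, b p = (bw p.1 p.2 : H) := fun p => by
    simp [b, HilbertBasis.coe_mkOfOrthogonalEqBot]
  have hev : ∀ p, a (b p) = p.1 • b p := fun p => by
    rw [hb]; exact Module.End.mem_eigenspace_iff.1 (bw p.1 p.2).2
  refine ⟨_, b, fun p => p.1.re.toNNReal, fun p => ?_⟩
  -- The eigenvalue equals `⟨b p, a (b p)⟩`, hence is real and nonnegative, and passing to
  -- `re.toNNReal` loses nothing.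
  have h0 := hpos.inner_nonneg_right (b p)
  rw [hev, inner_smul_right, inner_self_eq_norm_sq_to_K, b.orthonormal.1 p] at h0
  simp only [RCLike.ofReal_one, one_pow, mul_one, Complex.nonneg_iff] at h0
  rw [hev, Real.coe_toNNReal _ h0.1]
  congr 1
  exact Complex.ext rfl h0.2.symm

end Diagonal

/-! ### Counting eigenvalues and the min-max principle -/

section Counting

variable {H : Type u} [NormedAddCommGroup H] [InnerProductSpace ℂ H]
  {ι : Type*} {b : HilbertBasis ι ℂ H} {a : H →L[ℂ] H} {μ : ι → ℝ≥0}

theorem mem_span_image_hilbertBasis_iff (b : HilbertBasis ι ℂ H) (S : Finset ι) (x : H) :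
    x ∈ Submodule.span ℂ (b '' S) ↔ ∀ i ∉ S, inner ℂ (b i) x = 0 := by
  constructor
  · intro hx i hi
    induction hx using Submodule.span_induction with
    | mem y hy =>
      obtain ⟨j, hj, rfl⟩ := hy
      exact b.orthonormal.2 (by rintro rfl; exact hi hj)
    | zero => simp
    | add y z _ _ hy hz => rw [inner_add_right, hy, hz, add_zero]
    | smul c y _ hy => rw [inner_smul_right, hy, mul_zero]
  · intro h
    have hs := b.hasSum_repr x
    have hf : HasSum (fun i => b.repr x i • b i) (∑ i ∈ S, b.repr x i • b i) :=
      hasSum_sum_of_ne_finset_zero fun i hi => by rw [b.repr_apply_apply, h i hi, zero_smul]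
    rw [hs.unique hf]
    exact Submodule.sum_mem _ fun i hi =>
      Submodule.smul_mem _ _ (Submodule.subset_span ⟨i, hi, rfl⟩)

theorem finrank_span_image_hilbertBasis (b : HilbertBasis ι ℂ H) (S : Finset ι) :
    Module.finrank ℂ (Submodule.span ℂ (b '' S)) = S.card := by
  have hli : LinearIndependent ℂ fun i : S => b i :=
    b.orthonormal.linearIndependent.comp _ Subtype.val_injective
  have := finrank_span_eq_card hli
  rw [Fintype.card_coe] at this
  rw [← this, Set.image_eq_range]
  rfl

theorem exists_finset_of_le_encard {s : Set ι} {n : ℕ} (h : (n : ℕ∞) ≤ s.encard) :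
    ∃ S : Finset ι, ↑S ⊆ s ∧ S.card = n := by
  obtain ⟨t, hts, ht⟩ := Set.exists_subset_encard_eq h
  have hfin : t.Finite := Set.finite_of_encard_eq_coe ht
  refine ⟨hfin.toFinset, by simpa using hts, ?_⟩
  rw [hfin.encard_eq_coe_toFinset_card] at ht
  exact_mod_cast ht

theorem exists_finset_of_encard_lt {s : Set ι} {n : ℕ} (h : s.encard < n) :
    ∃ S : Finset ι, ↑S = s ∧ S.card < n := by
  have hfin : s.Finite := Set.encard_lt_top_iff.1 (h.trans (ENat.natCast_lt_top n))
  refine ⟨hfin.toFinset, by simp, ?_⟩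
  rw [hfin.encard_eq_coe_toFinset_card] at h
  exact_mod_cast h

/-- The minimum over finitely many entries still exceeds `r`. This gap is what later survives small
perturbations. -/
theorem exists_le_of_le_encard_lt {r : ℝ≥0} {n : ℕ}
    (h : ((n + 1 : ℕ) : ℕ∞) ≤ {i | r < μ i}.encard) :
    ∃ t > r, ∃ S : Finset ι, S.card = n + 1 ∧ ∀ i ∈ S, t ≤ μ i := by
  obtain ⟨S, hS, hc⟩ := exists_finset_of_le_encard h
  have hne : S.Nonempty := Finset.card_pos.1 (by omega)
  exact ⟨S.inf' hne μ, (Finset.lt_inf'_iff hne).2 fun i hi => hS hi, S, hc,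
    fun i hi => Finset.inf'_le μ hi⟩

theorem hasSum_norm_sq (b : HilbertBasis ι ℂ H) (x : H) :
    HasSum (fun i => ‖inner ℂ (b i) x‖ ^ 2) (‖x‖ ^ 2) := by
  have h := (b.hasSum_inner_mul_inner x x).mapL Complex.reCLM
  simp only [Complex.reCLM_apply] at h
  convert h using 2 with i
  · rw [← inner_conj_symm x (b i), Complex.conj_mul', ← Complex.ofReal_pow, Complex.ofReal_re]
  · exact (inner_self_eq_norm_sq (𝕜 := ℂ) x).symm

namespace IsDiagonal

theorem le_norm (ha : IsDiagonal b a μ) (i : ι) : (μ i : ℝ) ≤ ‖a‖ := by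
  have h := a.le_opNorm (b i)
  rw [ha i, norm_smul, b.orthonormal.1 i] at h
  simpa using h

/-- Otherwise infinitely many basis vectors of the unit ball would have images at mutual distance
greater than `r`, and no subsequence could be Cauchy. -/
theorem finite_of_isCompactOperator (ha : IsDiagonal b a μ) (hcomp : IsCompactOperator a)
    {r : ℝ≥0} (hr : 0 < r) : {i | r < μ i}.Finite := by
  by_contra hinf
  have hinf : {i | r < μ i}.Infinite := hinf
  let e := hinf.natEmbedding
  have hK := hcomp.isCompact_closure_image_closedBall 1
  obtain ⟨x, -, φ, hφ, hlim⟩ := hK.tendsto_subseq (x := fun n => a (b (e n)))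
    fun n => subset_closure ⟨b (e n), by simp [b.orthonormal.1], rfl⟩
  have hc := hlim.cauchySeq
  rw [Metric.cauchySeq_iff'] at hc
  obtain ⟨N, hN⟩ := hc r (by exact_mod_cast hr)
  have h1 := hN (N + 1) (by omega)
  have hne : (e (φ (N + 1)) : ι) ≠ e (φ N) := fun h => by
    have := hφ.injective (e.injective (Subtype.ext h))
    omega
  rw [dist_eq_norm] at h1
  simp only [Function.comp_apply] at h1
  have h2 : ‖inner ℂ (b (e (φ (N + 1)))) (a (b (e (φ (N + 1)))) - a (b (e (φ N))))‖ ≤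
      ‖a (b (e (φ (N + 1)))) - a (b (e (φ N)))‖ := by
    have := norm_inner_le_norm (𝕜 := ℂ) (b (e (φ (N + 1))))
      (a (b (e (φ (N + 1)))) - a (b (e (φ N))))
    rwa [b.orthonormal.1, one_mul] at this
  have h5 : inner ℂ (b (e (φ (N + 1)))) (a (b (e (φ (N + 1)))) - a (b (e (φ N)))) =
      ((μ (e (φ (N + 1))) : ℝ) : ℂ) := by
    rw [inner_sub_right, ha, ha, inner_smul_right, inner_smul_right, b.orthonormal.2 hne,
      inner_self_eq_norm_sq_to_K, b.orthonormal.1]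
    simp
  rw [h5, Complex.norm_real, NNReal.norm_eq] at h2
  have h3 : r < μ (e (φ (N + 1))) := (e (φ (N + 1))).2
  have h4 : (r : ℝ) < μ (e (φ (N + 1))) := by exact_mod_cast h3
  linarith

variable [CompleteSpace H]

theorem le_rank_iff (ha : IsDiagonal b a μ) (ha0 : 0 ≤ a) (t : ℝ≥0) (n : ℕ) :
    (n : Cardinal) ≤ Module.rank ℂ ↥(⨆ s ∈ Set.Ici t,
      Module.End.eigenspace (a : H →ₗ[ℂ] H) (((s : ℝ≥0) : ℝ) : ℂ)) ↔
      (n : ℕ∞) ≤ {i | t ≤ μ i}.encard := by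
  constructor
  · contrapose!
    intro h
    obtain ⟨S, hS, hn⟩ := exists_finset_of_encard_lt h
    have hle : (⨆ s ∈ Set.Ici t, Module.End.eigenspace (a : H →ₗ[ℂ] H) (((s : ℝ≥0) : ℝ) : ℂ)) ≤
        Submodule.span ℂ (b '' S) := by
      refine iSup₂_le fun s hs x hx => (mem_span_image_hilbertBasis_iff b S x).2 fun i hi => ?_
      have hi' : μ i < t := by
        have : i ∉ {i | t ≤ μ i} := by rwa [← hS, Finset.mem_coe]
        simpa using this
      have h1 := ha.inner_apply ha0 x i
      have h2 : a x = ((s : ℝ) : ℂ) • x := Module.End.mem_eigenspace_iff.1 hx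
      rw [h2, inner_smul_right] at h1
      refine (mul_eq_mul_right_iff.1 h1).resolve_left fun h3 => ?_
      have : s = μ i := by exact_mod_cast h3
      exact absurd hi' (not_lt.2 (this ▸ hs))
    refine (Submodule.rank_mono hle).trans_lt ?_
    have : FiniteDimensional ℂ (Submodule.span ℂ (b '' S)) :=
      FiniteDimensional.span_of_finite ℂ (S.finite_toSet.image b)
    rw [← Module.finrank_eq_rank, finrank_span_image_hilbertBasis]
    exact_mod_cast hn
  · intro h
    obtain ⟨S, hS, rfl⟩ := exists_finset_of_le_encard h
    have : FiniteDimensional ℂ (Submodule.span ℂ (b '' S)) :=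
      FiniteDimensional.span_of_finite ℂ (S.finite_toSet.image b)
    rw [← finrank_span_image_hilbertBasis b S, Module.finrank_eq_rank]
    refine Submodule.rank_mono (Submodule.span_le.2 ?_)
    rintro _ ⟨i, hi, rfl⟩
    refine (le_iSup₂_of_le (μ i) (hS hi) le_rfl : Module.End.eigenspace (a : H →ₗ[ℂ] H) _ ≤ _)
      (Module.End.mem_eigenspace_iff.2 (ha i))

/-- Courant–Fischer, with a strict threshold on both sides. -/
theorem exists_submodule_iff (ha : IsDiagonal b a μ) (ha0 : 0 ≤ a) (r : ℝ≥0) (n : ℕ) :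
    ((n + 1 : ℕ) : ℕ∞) ≤ {i | r < μ i}.encard ↔
      ∃ t > r, ∃ V : Submodule ℂ H, Module.finrank ℂ V = n + 1 ∧
        ∀ x ∈ V, t * ‖x‖ ^ 2 ≤ (inner ℂ x (a x)).re := by
  constructor
  · intro h
    obtain ⟨t, ht, S, hS, hle⟩ := exists_le_of_le_encard_lt h
    refine ⟨t, ht, Submodule.span ℂ (b '' S), by rw [finrank_span_image_hilbertBasis, hS],
      fun x hx => ?_⟩
    refine hasSum_le (fun i => ?_) ((hasSum_norm_sq b x).mul_left (t : ℝ))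
      (ha.hasSum_re_inner ha0 x)
    by_cases hi : i ∈ S
    · have := hle i hi
      gcongr
    · simp [(mem_span_image_hilbertBasis_iff b S x).1 hx i hi]
  · rintro ⟨t, ht, V, hV, hle⟩
    by_contra! h
    obtain ⟨S, hS, hn⟩ := exists_finset_of_encard_lt h
    have : FiniteDimensional ℂ V := Module.finite_of_finrank_pos (by omega)
    -- At most `n` coordinate conditions on a space of dimension `n + 1` leave a nonzero vector of
    -- `V` orthogonal to all basis vectors with entry above `r`; there the form is at most `r‖x‖²`.
    let φ : V →ₗ[ℂ] (S → ℂ) := LinearMap.pi fun i => (innerSL ℂ (b i)).toLinearMap ∘ₗ V.subtype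
    have hker : LinearMap.ker φ ≠ ⊥ := LinearMap.ker_ne_bot_of_finrank_lt (by simp; omega)
    obtain ⟨x, hx, hx0⟩ := (Submodule.ne_bot_iff _).1 hker
    have hxS : ∀ i ∈ S, inner ℂ (b i) (x : H) = 0 := fun i hi => by
      have := congrFun (LinearMap.mem_ker.1 hx) ⟨i, hi⟩
      simpa [φ] using this
    have hup : (inner ℂ (x : H) (a x)).re ≤ r * ‖(x : H)‖ ^ 2 := by
      refine hasSum_le (fun i => ?_) (ha.hasSum_re_inner ha0 x)
        ((hasSum_norm_sq b (x : H)).mul_left (r : ℝ))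
      by_cases hi : i ∈ S
      · simp [hxS i hi]
      · have : i ∉ {i | r < μ i} := by rwa [← hS, Finset.mem_coe]
        have : μ i ≤ r := by simpa using this
        gcongr
    have hpos : 0 < ‖(x : H)‖ ^ 2 := by
      have : (x : H) ≠ 0 := by simpa using hx0
      positivity
    have h3 := (hle x x.2).trans hup
    have h4 : (r : ℝ) < t := by exact_mod_cast ht
    nlinarith

theorem lt_eigenvalueSeq_iff {a : KPos H} (ha : IsDiagonal b a.1 μ) (r : ℝ≥0) (n : ℕ) :
    r < a.eigenvalueSeq n ↔ ((n + 1 : ℕ) : ℕ∞) ≤ {i | r < μ i}.encard := by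
  have hset : ∀ t : ℝ≥0, t ∈ {t : ℝ≥0 | ((n + 1 : ℕ) : Cardinal) ≤
      Module.rank ℂ ↥(⨆ s ∈ Set.Ici t,
        Module.End.eigenspace (a.1 : H →ₗ[ℂ] H) (((s : ℝ≥0) : ℝ) : ℂ))} ↔
      ((n + 1 : ℕ) : ℕ∞) ≤ {i | t ≤ μ i}.encard := fun t => ha.le_rank_iff a.2.2 t (n + 1)
  -- Without this bound the supremum would take its default value.
  have hbdd : BddAbove {t : ℝ≥0 | ((n + 1 : ℕ) : Cardinal) ≤
      Module.rank ℂ ↥(⨆ s ∈ Set.Ici t,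
        Module.End.eigenspace (a.1 : H →ₗ[ℂ] H) (((s : ℝ≥0) : ℝ) : ℂ))} := by
    refine ⟨‖a.1‖₊, fun t ht => ?_⟩
    obtain ⟨S, hS, hc⟩ := exists_finset_of_le_encard ((hset t).1 ht)
    obtain ⟨i, hi⟩ : S.Nonempty := Finset.card_pos.1 (by omega)
    exact le_trans (hS hi) (by exact_mod_cast ha.le_norm i)
  rw [KPos.eigenvalueSeq, lt_csSup_iff' hbdd]
  constructor
  · rintro ⟨t, ht, hrt⟩
    exact ((hset t).1 ht).trans (Set.encard_le_encard fun i hi => lt_of_lt_of_le hrt hi)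
  · intro h
    obtain ⟨t, ht, S, hS, hle⟩ := exists_le_of_le_encard_lt h
    refine ⟨t, (hset t).2 ?_, ht⟩
    rw [← hS, ← Set.encard_coe_eq_coe_finsetCard]
    exact Set.encard_le_encard fun i hi => hle i hi

theorem lt_sugenoTrace_iff {a : KPos H} (ha : IsDiagonal b a.1 μ) (α : ℕ → ℝ≥0) (r : ℝ≥0) :
    (r : ℝ≥0∞) < sugenoTrace α a ↔
      ∃ n, r < α (n + 1) ∧ ((n + 1 : ℕ) : ℕ∞) ≤ {i | r < μ i}.encard := by
  simp only [sugenoTrace, lt_iSup_iff, ENNReal.coe_lt_coe, lt_min_iff, ha.lt_eigenvalueSeq_iff,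
    and_comm]

end IsDiagonal

theorem lt_sugenoTrace_iff_exists_submodule [CompleteSpace H] (α : ℕ → ℝ≥0) (a : KPos H)
    (r : ℝ≥0) : (r : ℝ≥0∞) < sugenoTrace α a ↔
      ∃ n, r < α (n + 1) ∧ ∃ t > r, ∃ V : Submodule ℂ H, Module.finrank ℂ V = n + 1 ∧
        ∀ x ∈ V, t * ‖x‖ ^ 2 ≤ (inner ℂ x (a.1 x)).re := by
  obtain ⟨ι, b, μ, ha⟩ := exists_isDiagonal a.2.1 a.2.2
  simp only [ha.lt_sugenoTrace_iff, ha.exists_submodule_iff a.2.2]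

end Counting

/-! ### Finite-rank projections -/

section Projection

variable {H : Type u} [NormedAddCommGroup H] [InnerProductSpace ℂ H]

/-- An isometry from `V` onto `W` extends to a unitary of the finite-dimensional space `V ⊔ W`; take
the identity on the orthogonal complement. -/
theorem exists_linearIsometryEquiv_map_eq {V W : Submodule ℂ H} [FiniteDimensional ℂ V]
    [FiniteDimensional ℂ W] (h : Module.finrank ℂ V = Module.finrank ℂ W) :
    ∃ e : H ≃ₗᵢ[ℂ] H, V.map (e.toLinearEquiv : H →ₗ[ℂ] H) = W := by
  let F := V ⊔ W
  have hV : V ≤ F := le_sup_left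
  have hW : W ≤ F := le_sup_right
  let V' := V.submoduleOf F
  have hV' : Module.finrank ℂ V' = Module.finrank ℂ W := by
    rw [← h]; exact (Submodule.submoduleOfEquivOfLe hV).finrank_eq
  let L₁ : V' ≃ₗᵢ[ℂ] W :=
    (stdOrthonormalBasis ℂ V').repr.trans
      ((stdOrthonormalBasis ℂ W).reindex (finCongr hV'.symm)).repr.symm
  let L₂ : W →ₗᵢ[ℂ] F := ⟨Submodule.inclusion hW, fun x => rfl⟩
  let T : F ≃ₗᵢ[ℂ] F := (L₂.comp L₁.toLinearIsometry).extend.toLinearIsometryEquiv rfl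
  let e : H ≃ₗᵢ[ℂ] H := F.orthogonalDecomposition.trans
    ((LinearIsometryEquiv.withLpProdCongr 2 T (LinearIsometryEquiv.refl ℂ Fᗮ)).trans
      F.orthogonalDecomposition.symm)
  have he : ∀ x ∈ V, e x ∈ W := by
    intro x hx
    have h1 : T ⟨x, hV hx⟩ = L₂ (L₁ ⟨⟨x, hV hx⟩, hx⟩) :=
      LinearIsometry.extend_apply (L₂.comp L₁.toLinearIsometry) ⟨⟨x, hV hx⟩, hx⟩
    have h2 : e x = T ⟨x, hV hx⟩ := by
      simp only [e, LinearIsometryEquiv.trans_apply]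
      rw [LinearIsometryEquiv.symm_apply_eq]
      have hp : F.orthogonalProjectionOnto x = ⟨x, hV hx⟩ :=
        Submodule.orthogonalProjectionOnto_mem_subspace_eq_self (⟨x, hV hx⟩ : F)
      have hF : ∀ y ∈ F, Fᗮ.orthogonalProjectionOnto y = 0 := fun y hy =>
        Submodule.orthogonalProjectionOnto_orthogonal_apply_eq_zero hy
      simp [Submodule.orthogonalDecomposition_apply, hp, hF x (hV hx), hF _ (T ⟨x, hV hx⟩).2]
    rw [h2, h1]
    exact (L₁ _).2
  refine ⟨e, Submodule.eq_of_le_of_finrank_eq ?_ ?_⟩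
  · rintro _ ⟨x, hx, rfl⟩
    exact he x hx
  · rw [← h]
    exact LinearEquiv.finrank_map_eq e.toLinearEquiv V

variable [CompleteSpace H]

/-- The orthogonal projection onto a finite-dimensional subspace, as an element of `K(H)⁺`. -/
noncomputable def KPos.proj (V : Submodule ℂ H) [FiniteDimensional ℂ V] : KPos H :=
  ⟨V.starProjection, by
    have : ProperSpace V := FiniteDimensional.proper ℂ V
    have : IsCompactOperator (V.orthogonalProjectionOnto : H →L[ℂ] V) :=
      isCompactOperator_of_locallyCompactSpace_dom V.orthogonalProjectionOnto
    exact this.clm_comp V.subtypeL,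
    (isStarProjection_starProjection).nonneg⟩

theorem KPos.proj_scale_conj {V W : Submodule ℂ H} [FiniteDimensional ℂ V]
    [FiniteDimensional ℂ W] (h : Module.finrank ℂ V = Module.finrank ℂ W) (c : ℝ≥0) :
    ∃ u : unitary (H →L[ℂ] H), KPos.conj u ((KPos.proj V).scale c) = (KPos.proj W).scale c := by
  obtain ⟨e, rfl⟩ := exists_linearIsometryEquiv_map_eq h
  refine ⟨Unitary.linearIsometryEquiv.symm e, Subtype.ext ?_⟩
  ext x
  have hs : star ((Unitary.linearIsometryEquiv.symm e : unitary (H →L[ℂ] H)) : H →L[ℂ] H) x =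
      e.symm x := by
    rw [ContinuousLinearMap.star_eq_adjoint, Unitary.coe_symm_linearIsometryEquiv_apply,
      LinearIsometryEquiv.adjoint_eq_symm]
    rfl
  simp only [KPos.conj, KPos.scale, KPos.proj, mul_apply_eq_comp, hs, smul_apply]
  rw [Submodule.starProjection_map_apply]
  simp

namespace IsDiagonal

variable {ι : Type*} {b : HilbertBasis ι ℂ H} {a c : KPos H} {μ ν : ι → ℝ≥0}

theorem kPos_le (ha : IsDiagonal b a.1 μ) (hc : IsDiagonal b c.1 ν) (h : ∀ i, μ i ≤ ν i) : a ≤ c :=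
  ha.le_of_le hc a.2.2 c.2.2 h

theorem scale (ha : IsDiagonal b a.1 μ) (k : ℝ≥0) :
    IsDiagonal b (a.scale k).1 fun i => k * μ i := by
  intro i
  rw [KPos.scale, smul_apply, ha i, ← Complex.coe_smul, smul_smul]
  push_cast
  rfl

theorem funcCalc (ha : IsDiagonal b a.1 μ) {f : ℝ≥0 → ℝ≥0} (hf0 : f 0 = 0)
    (hf : ContinuousOn f (spectrum ℝ≥0 a.1)) :
    IsDiagonal b (a.funcCalc f hf0).1 fun i => f (μ i) :=
  ha.cfc a.2.2 hf

theorem truncate (ha : IsDiagonal b a.1 μ) (k : ℝ≥0) :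
    IsDiagonal b (a.truncate k).1 fun i => min k (μ i) :=
  ha.funcCalc (f := fun x => min k x) (by simp) (by fun_prop)

open Classical in
theorem proj_span (b : HilbertBasis ι ℂ H) (S : Finset ι)
    [FiniteDimensional ℂ (Submodule.span ℂ (b '' S))] :
    IsDiagonal b (KPos.proj (Submodule.span ℂ (b '' S))).1 fun i => if i ∈ S then 1 else 0 := by
  intro i
  by_cases hi : i ∈ S
  · simp only [KPos.proj, hi, if_true, NNReal.coe_one, Complex.ofReal_one, one_smul]
    exact Submodule.starProjection_eq_self_iff.2 (Submodule.subset_span ⟨i, hi, rfl⟩)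
  · simp only [KPos.proj, hi, if_false, NNReal.coe_zero, Complex.ofReal_zero, zero_smul]
    refine Submodule.starProjection_apply_eq_zero_iff _ |>.2
      ((Submodule.mem_orthogonal _ _).2 fun x hx => ?_)
    rw [← inner_conj_symm, (mem_span_image_hilbertBasis_iff b S x).1 hx i hi, map_zero]

end IsDiagonal

theorem KPos.truncate_scale_proj (V : Submodule ℂ H) [FiniteDimensional ℂ V] {k c : ℝ≥0}
    (hkc : k ≤ c) : ((KPos.proj V).scale c).truncate k = (KPos.proj V).scale k := by
  obtain ⟨ι, b, μ, hd⟩ := exists_isDiagonal (KPos.proj V).2.1 (KPos.proj V).2.2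
  -- Idempotence leaves only these entries, and on `0` and `c ≥ k` truncation at `k` acts as
  -- rescaling to `k`.
  have hμ : ∀ i, μ i = 0 ∨ μ i = 1 := by
    intro i
    have h1 : (KPos.proj V).1 ((KPos.proj V).1 (b i)) = (KPos.proj V).1 (b i) :=
      Submodule.starProjection_eq_self_iff.2 (Submodule.starProjection_apply_mem V (b i))
    rw [hd i, map_smul, hd i, smul_smul] at h1
    have h2 := smul_left_injective ℂ (b.orthonormal.ne_zero i) h1
    have h3 : μ i * μ i = μ i := by exact_mod_cast h2
    rcases eq_or_ne (μ i) 0 with h | h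
    · exact .inl h
    · exact .inr (mul_left_cancel₀ h (by rw [h3, mul_one]))
  refine Subtype.ext (IsDiagonal.eq ((hd.scale c).truncate k) ?_)
  convert hd.scale k using 1
  ext i
  rcases hμ i with h | h <;> simp [h, hkc]

end Projection

/-! ### Properties of the Sugeno trace -/

section Necessity

variable {H : Type u} [NormedAddCommGroup H] [InnerProductSpace ℂ H] [CompleteSpace H]
  {ψ : KPos H → ℝ≥0} {α : ℕ → ℝ≥0}

theorem lt_iff_of_eq_sugenoTrace (hψ : ∀ a, (ψ a : ℝ≥0∞) = sugenoTrace α a)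
    {ι : Type*} {b : HilbertBasis ι ℂ H} {a : KPos H} {μ : ι → ℝ≥0} (ha : IsDiagonal b a.1 μ)
    (r : ℝ≥0) :
    r < ψ a ↔ ∃ n, r < α (n + 1) ∧ ((n + 1 : ℕ) : ℕ∞) ≤ {i | r < μ i}.encard := by
  rw [← ha.lt_sugenoTrace_iff, ← hψ, ENNReal.coe_lt_coe]

theorem lt_iff_exists_submodule_of_eq_sugenoTrace
    (hψ : ∀ a, (ψ a : ℝ≥0∞) = sugenoTrace α a) (a : KPos H) (r : ℝ≥0) :
    r < ψ a ↔ ∃ n, r < α (n + 1) ∧ ∃ t > r, ∃ V : Submodule ℂ H, Module.finrank ℂ V = n + 1 ∧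
        ∀ x ∈ V, t * ‖x‖ ^ 2 ≤ (inner ℂ x (a.1 x)).re := by
  rw [← lt_sugenoTrace_iff_exists_submodule, ← hψ, ENNReal.coe_lt_coe]

theorem comonotonicFAdditive_of_eq_sugenoTrace (hψ : ∀ a, (ψ a : ℝ≥0∞) = sugenoTrace α a) :
    ComonotonicFAdditive ψ := by
  intro a f g hf0 hg0 hf hg hfg
  obtain ⟨ι, b, μ, ha⟩ := exists_isDiagonal a.2.1 a.2.2
  refine eq_of_forall_lt_iff fun r => ?_
  rw [lt_max_iff, lt_iff_of_eq_sugenoTrace hψ (ha.funcCalc hf0 hf),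
    lt_iff_of_eq_sugenoTrace hψ (ha.funcCalc hg0 hg),
    lt_iff_of_eq_sugenoTrace hψ (ha.funcCalc (f := fun x => max (f x) (g x))
      (by simp [hf0, hg0]) (hf.sup hg))]
  have hu : {i | r < max (f (μ i)) (g (μ i))} = {i | r < f (μ i)} ∪ {i | r < g (μ i)} := by
    ext i; simp
  -- Comonotonicity means nested superlevel sets, so their union has the larger of the two counts.
  have hcases : {i | r < f (μ i)} ⊆ {i | r < g (μ i)} ∨
      {i | r < g (μ i)} ⊆ {i | r < f (μ i)} := by
    by_contra! h
    obtain ⟨i, hi, hi'⟩ := Set.not_subset.1 h.1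
    obtain ⟨j, hj, hj'⟩ := Set.not_subset.1 h.2
    simp only [Set.mem_ofPred_eq, not_lt] at hi hi' hj hj'
    have h1 := hfg _ (ha.mem_spectrum i) _ (ha.mem_spectrum j)
    have h2 : (f (μ j) : ℝ) < f (μ i) := by exact_mod_cast hj'.trans_lt hi
    have h3 : (g (μ i) : ℝ) < g (μ j) := by exact_mod_cast hi'.trans_lt hj
    nlinarith
  rw [hu, ← exists_or]
  refine exists_congr fun n => ?_
  rw [← and_or_left]
  refine and_congr_right fun _ => ?_
  rcases hcases with h | h
  · rw [Set.union_eq_right.2 h]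
    exact ⟨.inr, fun h' => h'.elim (fun h'' => h''.trans (Set.encard_le_encard h)) id⟩
  · rw [Set.union_eq_left.2 h]
    exact ⟨.inl, fun h' => h'.elim id (fun h'' => h''.trans (Set.encard_le_encard h))⟩

theorem monotone_of_eq_sugenoTrace (hψ : ∀ a, (ψ a : ℝ≥0∞) = sugenoTrace α a) :
    Monotone ψ := by
  intro a c hac
  refine le_of_forall_lt fun r hr => ?_
  rw [lt_iff_exists_submodule_of_eq_sugenoTrace hψ] at hr ⊢
  obtain ⟨n, hn, t, ht, V, hV, hle⟩ := hr
  exact ⟨n, hn, t, ht, V, hV, fun x hx =>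
    (hle x hx).trans ((le_iff_re_inner_le a.2.2 c.2.2).1 hac x)⟩

theorem unitarilyInvariant_of_eq_sugenoTrace (hψ : ∀ a, (ψ a : ℝ≥0∞) = sugenoTrace α a) :
    UnitarilyInvariant ψ := by
  have key : ∀ (a : KPos H) (u : unitary (H →L[ℂ] H)), ψ a ≤ ψ (KPos.conj u a) := by
    intro a u
    refine le_of_forall_lt fun r hr => ?_
    rw [lt_iff_exists_submodule_of_eq_sugenoTrace hψ] at hr ⊢
    obtain ⟨n, hn, t, ht, V, hV, hle⟩ := hr
    let e := Unitary.linearIsometryEquiv u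
    refine ⟨n, hn, t, ht, V.map (e.toLinearEquiv : H →ₗ[ℂ] H),
      by rw [← hV]; exact LinearEquiv.finrank_map_eq e.toLinearEquiv V, ?_⟩
    rintro _ ⟨x, hx, rfl⟩
    have hux : (star (u : H →L[ℂ] H)) ((u : H →L[ℂ] H) x) = x := by
      rw [← mul_apply_eq_comp, Unitary.coe_star_mul_self]; rfl
    have h1 : inner ℂ ((u : H →L[ℂ] H) x) ((KPos.conj u a).1 ((u : H →L[ℂ] H) x)) =
        inner ℂ x (a.1 x) := by
      simp only [KPos.conj, mul_apply_eq_comp, hux]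
      exact Unitary.inner_map_map u _ _
    have h2 : ‖(u : H →L[ℂ] H) x‖ = ‖x‖ := Unitary.norm_map u x
    change t * ‖(u : H →L[ℂ] H) x‖ ^ 2 ≤
      (inner ℂ ((u : H →L[ℂ] H) x) ((KPos.conj u a).1 ((u : H →L[ℂ] H) x))).re
    rw [h1, h2]
    exact hle x hx
  intro a u
  refine le_antisymm ?_ (key a u)
  have h := key (KPos.conj u a) (star u)
  have h2 : KPos.conj (star u) (KPos.conj u a) = a := by
    refine Subtype.ext ?_
    have h3 : star (u : H →L[ℂ] H) * u = 1 := Unitary.coe_star_mul_self u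
    simp only [KPos.conj, Unitary.coe_star, star_star]
    calc star (u : H →L[ℂ] H) * (u * a.1 * star (u : H →L[ℂ] H)) * u
        = (star (u : H →L[ℂ] H) * u) * a.1 * (star (u : H →L[ℂ] H) * u) := by
          simp only [mul_assoc]
      _ = a.1 := by rw [h3, one_mul, mul_one]
  rwa [h2] at h

theorem positivelyFHomogeneous_of_eq_sugenoTrace
    (hψ : ∀ a, (ψ a : ℝ≥0∞) = sugenoTrace α a) : PositivelyFHomogeneous ψ := by
  intro a k
  obtain ⟨ι, b, μ, ha⟩ := exists_isDiagonal a.2.1 a.2.2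
  refine eq_of_forall_lt_iff fun r => ?_
  rw [lt_min_iff, lt_iff_of_eq_sugenoTrace hψ (ha.truncate k), lt_iff_of_eq_sugenoTrace hψ ha]
  by_cases hk : r < k
  · simp [hk]
  · simp [hk]

/-- The same test subspace works for nearby operators: a perturbation of norm below `t - s` lowers
the bound on the form from `t` to no less than `s`, still above `r`. -/
theorem lowerSemicontinuous_of_eq_sugenoTrace (hψ : ∀ a, (ψ a : ℝ≥0∞) = sugenoTrace α a) :
    LowerSemicontinuous ψ := by
  intro a r hr
  obtain ⟨n, hn, t, ht, V, hV, hle⟩ := (lt_iff_exists_submodule_of_eq_sugenoTrace hψ a r).1 hr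
  obtain ⟨s, hrs, hst⟩ := exists_between ht
  have hpos : (0 : ℝ) < t - s := sub_pos.2 (by exact_mod_cast hst)
  filter_upwards [Metric.ball_mem_nhds a hpos] with c hc
  refine (lt_iff_exists_submodule_of_eq_sugenoTrace hψ c r).2
    ⟨n, hn, s, hrs, V, hV, fun x hx => ?_⟩
  have hnorm : ‖a.1 - c.1‖ < t - s := by
    rw [← dist_eq_norm, dist_comm]; exact hc
  have h1 := hle x hx
  have h2 : (inner ℂ x ((a.1 - c.1) x)).re ≤ (t - s) * ‖x‖ ^ 2 :=
    calc (inner ℂ x ((a.1 - c.1) x)).re ≤ ‖x‖ * ‖(a.1 - c.1) x‖ :=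
        re_inner_le_norm (𝕜 := ℂ) x ((a.1 - c.1) x)
      _ ≤ ‖x‖ * (‖a.1 - c.1‖ * ‖x‖) := by gcongr; exact (a.1 - c.1).le_opNorm x
      _ ≤ ‖x‖ * ((t - s) * ‖x‖) := by gcongr
      _ = (t - s) * ‖x‖ ^ 2 := by ring
  rw [sub_apply, inner_sub_right, Complex.sub_re] at h2
  linarith

theorem finiteLimitOnFiniteRank_of_eq_sugenoTrace (hα : Monotone α)
    (hψ : ∀ a, (ψ a : ℝ≥0∞) = sugenoTrace α a) : FiniteLimitOnFiniteRank ψ := by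
  intro a hfin
  obtain ⟨ι, b, μ, ha⟩ := exists_isDiagonal a.2.1 a.2.2
  set N := Module.finrank ℂ (LinearMap.range (a.1 : H →ₗ[ℂ] H)) with hN
  have hmono : Monotone fun c : ℝ≥0 => ψ (KPos.scale c a) := fun c d hcd =>
    monotone_of_eq_sugenoTrace hψ <| by
      change (c : ℝ) • a.1 ≤ (d : ℝ) • a.1
      exact smul_le_smul_of_nonneg_right (by exact_mod_cast hcd) a.2.2
  refine ⟨_, tendsto_atTop_ciSup hmono ⟨α N, ?_⟩⟩
  rintro _ ⟨c, rfl⟩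
  refine le_of_forall_lt fun r hr => ?_
  obtain ⟨n, hn, hcard⟩ := (lt_iff_of_eq_sugenoTrace hψ (ha.scale c) r).1 hr
  refine hn.trans_le (hα ?_)
  -- Basis vectors with nonzero entry lie in the range, so `n + 1 ≤ N` and `α N` bounds every `ψ(c
  -- a)`.
  obtain ⟨S, hS, hSc⟩ := exists_finset_of_le_encard hcard
  rw [← hSc, ← finrank_span_image_hilbertBasis b S]
  refine Submodule.finrank_mono (Submodule.span_le.2 ?_)
  rintro _ ⟨i, hi, rfl⟩
  have hμ : μ i ≠ 0 := fun h => by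
    have : r < c * μ i := hS hi
    simp [h] at this
  refine ⟨((μ i : ℝ) : ℂ)⁻¹ • b i, ?_⟩
  rw [map_smul, ContinuousLinearMap.coe_coe, ha i, smul_smul, inv_mul_cancel₀, one_smul]
  exact_mod_cast hμ

end Necessity

theorem ComonotonicFAdditive.monotonicIncreasingFAdditive {H : Type u} [NormedAddCommGroup H]
    [InnerProductSpace ℂ H] [CompleteSpace H] {ψ : KPos H → ℝ≥0} (h : ComonotonicFAdditive ψ) :
    MonotonicIncreasingFAdditive ψ := by
  intro a f g hf0 hg0 hf hg hfm hgm
  refine h a f g hf0 hg0 hf hg fun x hx y hy => ?_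
  rcases le_total x y with hxy | hxy
  · exact mul_nonneg_of_nonpos_of_nonpos (sub_nonpos.2 (by exact_mod_cast hfm hx hy hxy))
      (sub_nonpos.2 (by exact_mod_cast hgm hx hy hxy))
  · exact mul_nonneg (sub_nonneg.2 (by exact_mod_cast hfm hy hx hxy))
      (sub_nonneg.2 (by exact_mod_cast hgm hy hx hxy))

/-! ### Reconstruction of `α` from the axioms -/

section Sufficiency

variable {H : Type u} [NormedAddCommGroup H] [InnerProductSpace ℂ H]

theorem finiteDimensional_of_hilbertBasis_finite {ι : Type*} [Finite ι]
    (b : HilbertBasis ι ℂ H) : FiniteDimensional ℂ H := by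
  have := Fintype.ofFinite ι
  exact Module.Finite.of_basis b.toOrthonormalBasis.toBasis

variable [CompleteSpace H] {ψ : KPos H → ℝ≥0}

/-- For `c ≥ k` truncating `c p` at `k` gives `k p`, so `ψ(k p) = k ∧ ψ(c p)`; now let `c → ∞`.
Conjugacy of projections of equal rank makes `L` independent of `V`. -/
theorem exists_scale_proj_eq_min (hu : UnitarilyInvariant ψ) (hh : PositivelyFHomogeneous ψ)
    (hl : FiniteLimitOnFiniteRank ψ) (n : ℕ) :
    ∃ L : ℝ≥0, ∀ (V : Submodule ℂ H) [FiniteDimensional ℂ V], Module.finrank ℂ V = n →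
      ∀ k, ψ ((KPos.proj V).scale k) = min k L := by
  by_cases hex : ∃ V : Submodule ℂ H, FiniteDimensional ℂ V ∧ Module.finrank ℂ V = n
  swap
  · exact ⟨0, fun V _ hV => absurd ⟨V, ‹_›, hV⟩ hex⟩
  obtain ⟨V₀, _, hV₀⟩ := hex
  have hr : LinearMap.range ((KPos.proj V₀).1 : H →ₗ[ℂ] H) = V₀ :=
    Submodule.range_starProjection V₀
  obtain ⟨L, hL⟩ := hl (KPos.proj V₀) (by rw [hr]; infer_instance)
  refine ⟨L, fun V _ hV k => ?_⟩
  obtain ⟨u, hconj⟩ := KPos.proj_scale_conj (hV₀.trans hV.symm) k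
  rw [← hconj, hu]
  have h1 : Filter.Tendsto (fun c : ℝ≥0 => min k (ψ ((KPos.proj V₀).scale c))) Filter.atTop
      (𝓝 (min k L)) := tendsto_const_nhds.min hL
  refine tendsto_nhds_unique (tendsto_const_nhds.congr' ?_) h1
  filter_upwards [Filter.eventually_ge_atTop k] with c hc
  rw [← hh, KPos.truncate_scale_proj V₀ hc]

theorem le_max_of_scale_proj_eq (hm : MonotonicIncreasingFAdditive ψ) (hmono : Monotone ψ)
    (hh : PositivelyFHomogeneous ψ) {α : ℕ → ℝ≥0}
    (hα : ∀ (V : Submodule ℂ H) [FiniteDimensional ℂ V] (k : ℝ≥0),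
      ψ ((KPos.proj V).scale k) = min k (α (Module.finrank ℂ V)))
    {a : KPos H} {ι : Type*} {b : HilbertBasis ι ℂ H} {μ : ι → ℝ≥0} (ha : IsDiagonal b a.1 μ)
    {r : ℝ≥0} {S : Finset ι} (hS : ∀ i, i ∈ S ↔ r < μ i) : ψ a ≤ max r (α S.card) := by
  classical
  obtain ⟨t, hrt, ht⟩ : ∃ t > r, ∀ i ∈ S, t ≤ μ i := by
    rcases S.eq_empty_or_nonempty with rfl | hne
    · exact ⟨r + 1, by simp, by simp⟩
    · exact ⟨S.inf' hne μ, (Finset.lt_inf'_iff hne).2 fun i hi => (hS i).1 hi,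
        fun i hi => Finset.inf'_le μ hi⟩
  let M := ‖a.1‖₊
  -- A continuous ramp, `0` up to `r` (truncated subtraction) and `M` from `t` on. No entry lies
  -- strictly between, so `g(a)` is exactly `M` times the spectral projection.
  let g : ℝ≥0 → ℝ≥0 := fun x => min M (M / (t - r) * (x - r))
  have hg0 : g 0 = 0 := by simp [g]
  have hgc : Continuous g := by fun_prop
  have hgm : Monotone g := fun x y hxy => by dsimp only [g]; gcongr
  have hgS : ∀ i, g (μ i) = M * if i ∈ S then 1 else 0 := by
    intro i
    split_ifs with hi
    · have h1 : t - r ≠ 0 := (tsub_pos_of_lt hrt).ne'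
      have h2 : M ≤ M / (t - r) * (μ i - r) :=
        calc M = M / (t - r) * (t - r) := (div_mul_cancel₀ _ h1).symm
          _ ≤ _ := by have := ht i hi; gcongr
      simp [g, h2]
    · have : μ i ≤ r := not_lt.1 fun h => hi ((hS i).2 h)
      simp [g, tsub_eq_zero_of_le this]
  have : FiniteDimensional ℂ (Submodule.span ℂ (b '' S)) :=
    FiniteDimensional.span_of_finite ℂ (S.finite_toSet.image b)
  have hga : a.funcCalc g hg0 = (KPos.proj (Submodule.span ℂ (b '' S))).scale M := by
    refine Subtype.ext (IsDiagonal.eq (ha.funcCalc hg0 hgc.continuousOn) ?_)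
    convert (IsDiagonal.proj_span b S).scale M using 1
    exact funext hgS
  have hadd := hm a (fun x => min r x) g (by simp) hg0 (by fun_prop) hgc.continuousOn
    (fun x _ y _ hxy => by dsimp only; gcongr) (hgm.monotoneOn _)
  have htr : ψ (a.funcCalc (fun x => min r x) (by simp)) = min r (ψ a) := hh a r
  rw [htr, hga, hα, finrank_span_image_hilbertBasis] at hadd
  have hle : a ≤ a.funcCalc (fun x => max (min r x) (g x)) (by simp [hg0]) := by
    refine ha.kPos_le (ha.funcCalc (f := fun x => max (min r x) (g x)) (by simp [hg0])
      (by fun_prop)) fun i => ?_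
    by_cases hi : i ∈ S
    · refine le_max_of_le_right ?_
      rw [hgS, if_pos hi, mul_one]
      exact_mod_cast ha.le_norm i
    · exact le_max_of_le_left (le_min (not_lt.1 fun h => hi ((hS i).2 h)) le_rfl)
  refine (hmono hle).trans ?_
  rw [hadd]
  exact max_le_max (min_le_left _ _) (min_le_right _ _)

theorem exists_eq_sugenoTrace (hH : ¬ FiniteDimensional ℂ H)
    (hm : MonotonicIncreasingFAdditive ψ) (hu : UnitarilyInvariant ψ) (hmono : Monotone ψ)
    (hh : PositivelyFHomogeneous ψ) (hl : FiniteLimitOnFiniteRank ψ) :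
    ∃ α : ℕ → ℝ≥0, Monotone α ∧ α 0 = 0 ∧ ∀ a, (ψ a : ℝ≥0∞) = sugenoTrace α a := by
  classical
  choose α hα' using exists_scale_proj_eq_min hu hh hl
  have hα : ∀ (V : Submodule ℂ H) [FiniteDimensional ℂ V] (k : ℝ≥0),
      ψ ((KPos.proj V).scale k) = min k (α (Module.finrank ℂ V)) := fun V _ k => hα' _ V rfl k
  have hspan : ∀ {ι : Type u} (b : HilbertBasis ι ℂ H) (S : Finset ι),
      FiniteDimensional ℂ (Submodule.span ℂ (b '' S)) := fun b S =>
    FiniteDimensional.span_of_finite ℂ (S.finite_toSet.image b)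
  have hαmono : Monotone α := by
    refine monotone_nat_of_le_succ fun n => ?_
    obtain ⟨w, b, -⟩ := exists_hilbertBasis ℂ H
    have : Infinite w := by
      by_contra h
      have := not_infinite_iff_finite.1 h
      exact hH (finiteDimensional_of_hilbertBasis_finite b)
    -- Infinite dimension supplies nested projections of ranks `n` and `n + 1`; scaling both by `α
    -- n` turns monotonicity into `α n ≤ α n ∧ α (n + 1)`.
    obtain ⟨T, hT⟩ := Infinite.exists_subset_card_eq w (n + 1)
    obtain ⟨S, hST, hS⟩ := Finset.exists_subset_card_eq (s := T) (n := n) (by omega)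
    have := hspan b S
    have := hspan b T
    have h1 : (KPos.proj (Submodule.span ℂ (b '' S))).scale (α n) ≤
        (KPos.proj (Submodule.span ℂ (b '' T))).scale (α n) := by
      refine ((IsDiagonal.proj_span b S).scale (α n)).kPos_le
        ((IsDiagonal.proj_span b T).scale (α n)) fun i => ?_
      by_cases hi : i ∈ S
      · simp [hi, hST hi]
      · simp [hi]
    have h2 := hmono h1
    rw [hα, hα, finrank_span_image_hilbertBasis, finrank_span_image_hilbertBasis, hS, hT,
      min_self] at h2
    exact h2.trans (min_le_right _ _)
  have hα0 : α 0 = 0 := by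
    have h1 := hα (⊥ : Submodule ℂ H) 1
    rw [finrank_bot] at h1
    have h2 : (KPos.proj (⊥ : Submodule ℂ H)).scale 1 =
        ((KPos.proj (⊥ : Submodule ℂ H)).scale 1).truncate 0 := by
      rw [KPos.truncate_scale_proj _ zero_le_one]
      refine Subtype.ext ?_
      simp [KPos.scale, KPos.proj]
    rw [h2, hh] at h1
    simpa using h1.symm
  refine ⟨α, hαmono, hα0, fun a => ?_⟩
  obtain ⟨ι, b, μ, ha⟩ := exists_isDiagonal a.2.1 a.2.2
  -- Only for `r > 0` does compactness make the superlevel set finite. The case `r = 0` is reached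
  -- below through some `s` strictly between `0` and `ψ a`.
  have hpos : ∀ r : ℝ≥0, 0 < r → r < ψ a →
      ∃ n, r < α (n + 1) ∧ ((n + 1 : ℕ) : ℕ∞) ≤ {i | r < μ i}.encard := by
    intro r hr hlt
    have hfin := ha.finite_of_isCompactOperator a.2.1 hr
    have h1 := le_max_of_scale_proj_eq hm hmono hh hα ha (r := r) (S := hfin.toFinset) (by simp)
    have h2 : r < α hfin.toFinset.card := (lt_max_iff.1 (hlt.trans_le h1)).resolve_left (lt_irrefl r)
    have h3 : hfin.toFinset.card ≠ 0 := fun h => by simp [h, hα0] at h2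
    obtain ⟨n, hn⟩ := Nat.exists_eq_succ_of_ne_zero h3
    refine ⟨n, by rwa [hn] at h2, ?_⟩
    rw [hfin.encard_eq_coe_toFinset_card, hn]
  have hiff : ∀ r : ℝ≥0, r < ψ a ↔ (r : ℝ≥0∞) < sugenoTrace α a := by
    intro r
    rw [ha.lt_sugenoTrace_iff]
    constructor
    · intro hlt
      obtain ⟨s, hrs, hs⟩ := exists_between hlt
      obtain ⟨n, hn, hcard⟩ := hpos s (hrs.pos) hs
      rcases eq_or_ne r 0 with rfl | hr
      · exact ⟨n, hrs.trans hn, hcard.trans (Set.encard_le_encard fun i hi => hrs.trans hi)⟩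
      · exact hpos r (pos_iff_ne_zero.2 hr) hlt
    · rintro ⟨n, hn, hcard⟩
      obtain ⟨t, ht, S, hS, hle⟩ := exists_le_of_le_encard_lt hcard
      have := hspan b S
      -- Lower bound: `t p ≤ a` with `p` of rank `n + 1`, and `ψ(t p) = t ∧ α (n + 1) > r`.
      have h1 : (KPos.proj (Submodule.span ℂ (b '' S))).scale t ≤ a := by
        refine ((IsDiagonal.proj_span b S).scale t).kPos_le ha fun i => ?_
        by_cases hi : i ∈ S
        · simpa [hi] using hle i hi
        · simp [hi]
      refine lt_of_lt_of_le ?_ (hmono h1)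
      rw [hα, finrank_span_image_hilbertBasis, hS]
      exact lt_min ht hn
  refine le_antisymm ?_ ?_
  · refine ENNReal.le_of_forall_nnreal_lt fun r hr => ?_
    exact ((hiff r).1 (by exact_mod_cast hr)).le
  · refine ENNReal.le_of_forall_nnreal_lt fun r hr => ?_
    exact_mod_cast ((hiff r).2 hr).le

end Sufficiency

end SugenoTrace

theorem mainTheorem2 {H : Type*} [NormedAddCommGroup H] [InnerProductSpace ℂ H] [CompleteSpace H]
    [TopologicalSpace.SeparableSpace H] (hH : ¬ FiniteDimensional ℂ H)
    (ψ : SugenoTrace.KPos H → ℝ≥0) :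
    List.TFAE [
      ∃ α : ℕ → ℝ≥0, Monotone α ∧ α 0 = 0 ∧
        ∀ a, (ψ a : ℝ≥0∞) = SugenoTrace.sugenoTrace α a,
      SugenoTrace.MonotonicIncreasingFAdditive ψ ∧ SugenoTrace.UnitarilyInvariant ψ ∧
        Monotone ψ ∧ SugenoTrace.PositivelyFHomogeneous ψ ∧ LowerSemicontinuous ψ ∧
        SugenoTrace.FiniteLimitOnFiniteRank ψ,
      SugenoTrace.ComonotonicFAdditive ψ ∧ SugenoTrace.UnitarilyInvariant ψ ∧
        Monotone ψ ∧ SugenoTrace.PositivelyFHomogeneous ψ ∧ LowerSemicontinuous ψ ∧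
        SugenoTrace.FiniteLimitOnFiniteRank ψ] := by
  tfae_have 1 → 3 := by
    rintro ⟨α, hα, -, hψ⟩
    exact ⟨SugenoTrace.comonotonicFAdditive_of_eq_sugenoTrace hψ,
      SugenoTrace.unitarilyInvariant_of_eq_sugenoTrace hψ,
      SugenoTrace.monotone_of_eq_sugenoTrace hψ,
      SugenoTrace.positivelyFHomogeneous_of_eq_sugenoTrace hψ,
      SugenoTrace.lowerSemicontinuous_of_eq_sugenoTrace hψ,
      SugenoTrace.finiteLimitOnFiniteRank_of_eq_sugenoTrace hα hψ⟩
  tfae_have 3 → 2 := fun h => ⟨h.1.monotonicIncreasingFAdditive, h.2⟩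
  tfae_have 2 → 1 := fun ⟨hm, hu, hmono, hh, _, hl⟩ =>
    SugenoTrace.exists_eq_sugenoTrace hH hm hu hmono hh hl
  tfae_finish
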